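/- Let $n\ge 1$ be an integer. A strict partition is a finite strictly decreasing sequence $\lambda=(\lambda_1>\lambda_2>\cdots>\lambda_\ell)$ of positive integers, with $\lambda_i=0$ for $i>\ell$. For strict partitions $\mu\subseteq\lambda$ (that is, $\mu_i\le\lambda_i$ for all $i$), the shifted skew diagram of $\lambda/\mu$ is the set of boxes $\{(i,j): i+\mu_i\le j\le i+\lambda_i-1\}$ ($i$ the row, $j$ the column). A marked shifted tableau $T$ of this shape is a filling of its boxes with letters of the ordered alphabet $1'<1<2'<2<\cdots$ such that rows and columns are weakly increasing, each column contains at most one $k$ and each row contains at most one $k'$, for every $k\ge1$. The skew Schur $Q$-function is $Q_{\lambda/\mu}=\sum_T x^{c(T)}$, the sum being over all such $T$, where $x^{c(T)}=\prod_i x_i^{c_i}$ and $c_i$ is the total number of letters $i$ and $i'$ in $T$. For $1\le k\le n$ let $\mathfrak r_{\triangle_{n,k}}=Q_{\lambda/\mu}$ with $\lambda=(n,n-1,\dots,n-k+1)$ and $\mu=(n-1,n-2,\dots,n-k+1)$ (where $\mu=\emptyset$ if $k=1$). Let $OP(n)$ be the set of partitions of $n$ into odd parts. For a partition $\lambda$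 let $m_i(\lambda)$ be the number of its parts equal to $i$, $\ell(\lambda)$ the number of its parts, $z_\lambda=\prod_i i^{m_i(\lambda)}m_i(\lambda)!$, and $p_\lambda=\prod_i p_{\lambda_i}$, where $p_r=\sum_i x_i^r$. A symmetric function with rational coefficients is called $p$-positive if it is a linear combination of finitely many $p_\lambda$ with positive coefficients. Then: (a) $\displaystyle \mathfrak r_{\triangle_{n,1}}=\sum_{\lambda\in OP(n)} z_\lambda^{-1}2^{\ell(\lambda)}\,p_\lambda$. (b) If $n\ge 3$, then $\displaystyle \mathfrak r_{\triangle_{n,3}}=\sum_{\lambda\in OP(n)} c_\lambda\,p_\lambda$, where $$c_\lambda=\begin{cases} z_\lambda^{-1}2^{\ell(\lambda)} & \text{if } m_1(\lambda)=0,\\ 0 & \text{if } m_1(\lambda)\in\{1,2\},\\ \binom{m_1(\lambda)-1}{2}\,z_\lambda^{-1}2^{\ell(\lambda)} & \text{if } m_1(\lambda)\ge 3.\end{cases}$$ Consequently $\mathfrak r_{\triangle_{n,1}}$ is $p$-positive, and so is $\mathfrak r_{\triangle_{n,3}}$ if $n\ge 3$. -/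

import Mathlib

namespace SchurQ

/-- A strict partition: a finite strictly decreasing sequence of positive integers. -/
structure StrictPartition where
  parts : List ℕ
  strict : parts.Pairwise (· > ·)
  pos : ∀ x ∈ parts, 0 < x

namespace StrictPartition

/-- The number of parts. -/
def length (la : StrictPartition) : ℕ := la.parts.length

/-- The `i`-th part (counted from `0`), which is `0` beyond the length. -/
def part (la : StrictPartition) (i : ℕ) : ℕ := la.parts.getD i 0

/-- Containment of diagrams. -/
instance : HasSubset StrictPartition := ⟨fun mu la => ∀ i, mu.part i ≤ la.part i⟩

end StrictPartition

/-- The shifted skew diagram of `la / mu`, as a set of boxes `(row, column)`; rows and columns are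
counted from `0`.  Row `i` of `la / mu` is shifted `i` boxes to the right. -/
def shiftedSkewDiagram (la mu : StrictPartition) (_h : mu ⊆ la) : Finset (ℕ × ℕ) :=
  (Finset.range la.length).biUnion fun i =>
    (Finset.Ico (i + mu.part i) (i + la.part i)).image fun j => (i, j)

theorem mem_shiftedSkewDiagram {la mu : StrictPartition} {h : mu ⊆ la} {b : ℕ × ℕ} :
    b ∈ shiftedSkewDiagram la mu h ↔ b.1 + mu.part b.1 ≤ b.2 ∧ b.2 < b.1 + la.part b.1 := by
  obtain ⟨i, j⟩ := b
  simp only [shiftedSkewDiagram, Finset.mem_biUnion, Finset.mem_range, Finset.mem_image,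
    Finset.mem_Ico, Prod.mk.injEq]
  constructor
  · rintro ⟨a, _, c, hc, rfl, rfl⟩
    exact hc
  · rintro ⟨h1, h2⟩
    refine ⟨i, ?_, j, ⟨h1, h2⟩, rfl, rfl⟩
    by_contra hi
    have : la.part i = 0 := List.getD_eq_default _ _ (not_lt.mp hi)
    simp only [this] at h2 h1
    omega

/-- The ordered alphabet `1' < 1 < 2' < 2 < ⋯`: the letter `k'` is `(k, false)` and the letter `k`
is `(k, true)`, in lexicographic order. -/
abbrev Letter : Type := ℕ+ ×ₗ Bool

/-- The unmarked version `|a|` of a letter. -/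
def Letter.abs (a : Letter) : ℕ+ := (ofLex a).1

/-- The letters `1', 2', …` are marked. -/
def Letter.IsMarked (a : Letter) : Prop := (ofLex a).2 = false

/-- Marked shifted tableaux of a given shape. -/
structure MarkedShiftedTableau (D : Finset (ℕ × ℕ)) where
  entry : D → Letter
  row_weak : ∀ a b : D, a.1.1 = b.1.1 → a.1.2 ≤ b.1.2 → entry a ≤ entry b
  col_weak : ∀ a b : D, a.1.2 = b.1.2 → a.1.1 ≤ b.1.1 → entry a ≤ entry b
  /-- Each column has at most one `k`, for each `k`. -/
  col_unmarked : ∀ a b : D, a.1.2 = b.1.2 → entry a = entry b → ¬ (entry a).IsMarked → a = b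
  /-- Each row has at most one `k'`, for each `k`. -/
  row_marked : ∀ a b : D, a.1.1 = b.1.1 → entry a = entry b → (entry a).IsMarked → a = b

/-- The content of a tableau: the number of `i` and `i'` in it, for each `i`. -/
noncomputable def MarkedShiftedTableau.content {D : Finset (ℕ × ℕ)}
    (T : MarkedShiftedTableau D) : ℕ+ →₀ ℕ :=
  ∑ b : D, Finsupp.single (T.entry b).abs 1

/-- There are only finitely many tableaux of given shape and content. -/
theorem finite_content_eq (D : Finset (ℕ × ℕ)) (c : ℕ+ →₀ ℕ) :
    Finite {T : MarkedShiftedTableau D // T.content = c} := by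
  have key : ∀ T : {T : MarkedShiftedTableau D // T.content = c}, ∀ b : D,
      (T.1.entry b).abs ∈ c.support := by
    rintro ⟨T, rfl⟩ b
    rw [Finsupp.mem_support_iff]
    intro h0
    unfold MarkedShiftedTableau.content at h0
    rw [Finsupp.finsetSum_apply, Finset.sum_eq_zero_iff] at h0
    simpa using h0 b (Finset.mem_univ b)
  let f : {T : MarkedShiftedTableau D // T.content = c} → (D → c.support × Bool) :=
    fun T b => (⟨(T.1.entry b).abs, key T b⟩, (ofLex (T.1.entry b)).2)
  refine Finite.of_injective f ?_
  rintro ⟨⟨e, _, _, _, _⟩, h⟩ ⟨⟨e', _, _, _, _⟩, h'⟩ hf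
  have : e = e' := by
    funext b
    have hb := congrFun hf b
    simp only [f, Prod.mk.injEq, Subtype.mk.injEq] at hb
    exact ofLex.injective (Prod.ext hb.1 hb.2)
  subst this
  rfl

/-- The generating function `∑ x ^ c(T)` over all marked shifted tableaux `T` of shape `D`, as a
formal power series in `x₁, x₂, …`: the coefficient of `x ^ c` is the number of tableaux
of content `c`. -/
noncomputable def tableauSeries (D : Finset (ℕ × ℕ)) : MvPowerSeries ℕ+ ℚ :=
  fun c => (Nat.card {T : MarkedShiftedTableau D // T.content = c} : ℚ)

/-- The skew Schur `Q`-function `Q_{la / mu}`. -/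
noncomputable def skewSchurQ (la mu : StrictPartition) (h : mu ⊆ la) : MvPowerSeries ℕ+ ℚ :=
  tableauSeries (shiftedSkewDiagram la mu h)

/-- The strict partition `(n, n - 1, …, n - k + 1)` with `k` parts. -/
def staircase (n k : ℕ) (hkn : k ≤ n) : StrictPartition where
  parts := (List.range k).map fun i => n - i
  strict := by
    rw [List.pairwise_map]
    refine (List.pairwise_lt_range (n := k)).imp_of_mem ?_
    intro a b ha hb hab
    rw [List.mem_range] at ha hb
    omega
  pos := by
    intro x hx
    rw [List.mem_map] at hx
    obtain ⟨i, hi, rfl⟩ := hx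
    rw [List.mem_range] at hi
    omega

theorem staircase_part (n k : ℕ) (hkn : k ≤ n) (i : ℕ) :
    (staircase n k hkn).part i = if i < k then n - i else 0 := by
  unfold staircase StrictPartition.part
  split_ifs with h
  · rw [List.getD_eq_getElem _ _ (by simpa using h)]
    simp
  · exact List.getD_eq_default _ _ (by simpa using h)

theorem staircase_subset (n k : ℕ) (hkn : k ≤ n) :
    staircase (n - 1) (k - 1) (Nat.sub_le_sub_right hkn 1) ⊆ staircase n k hkn := by
  intro i
  simp only [staircase_part]
  split_ifs <;> omega

/-- The function `𝔯_{△_{n,k}}` for `1 ≤ k ≤ n`: the skew Schur `Q`-function `Q_{la / mu}` with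
`la = (n, n - 1, …, n - k + 1)` and `mu = (n - 1, …, n - k + 1)` (empty if `k = 1`). -/
noncomputable def triangleQ (n k : ℕ) (_hk : 1 ≤ k) (hkn : k ≤ n) : MvPowerSeries ℕ+ ℚ :=
  skewSchurQ (staircase n k hkn) (staircase (n - 1) (k - 1) (Nat.sub_le_sub_right hkn 1))
    (staircase_subset n k hkn)

open Classical in
/-- The power sum `p_r = ∑ i, x_i ^ r`, for `r ≥ 1`. -/
noncomputable def powerSum (r : ℕ) : MvPowerSeries ℕ+ ℚ :=
  fun c => if ∃ i : ℕ+, c = Finsupp.single i r then 1 else 0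

/-- `p_la`, the product of the `p_r` over the parts `r` of `la`. -/
noncomputable def powerSumPart {n : ℕ} (la : n.Partition) : MvPowerSeries ℕ+ ℚ :=
  (la.parts.map powerSum).prod

/-- `z_la = ∏ i, i ^ m_i * m_i !`, where `m_i` is the number of parts of `la` equal to `i`. -/
def zee {n : ℕ} (la : n.Partition) : ℕ :=
  ∏ i ∈ la.parts.toFinset, i ^ la.parts.count i * (la.parts.count i).factorial

/-- A power series is `p`-positive if it is a linear combination with positive coefficients of
finitely many of the functions `p_la`, where `la` runs over the partitions of all
nonnegative integers. -/
def IsPPositive (f : MvPowerSeries ℕ+ ℚ) : Prop :=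
  ∃ (S : Finset (Σ n : ℕ, n.Partition)) (a : (Σ n : ℕ, n.Partition) → ℚ),
    (∀ la ∈ S, 0 < a la) ∧ f = ∑ la ∈ S, a la • powerSumPart la.2

end SchurQ

/-! The diagram is a hook: a row of n-k+1 boxes and a column of k boxes meeting in the bottom right
corner. Read from the left end of the row to the top of the column, a tableau is a word of length n
that satisfies the row rule up to the corner and the column rule from it (`exists_entry_eq_iff`).

If row and column are cut apart, so that no box is shared, the words are counted by a product q_a
q_b of one-row functions. At the cut, exactly one of the row rule and the column rule holds between
the two neighbouring letters, so the product is the sum of two adjacent hook series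
(`wordSeries_isHookWord_eq_add`). Telescoping gives q_{n-2} q_2 - q_{n-1} q_1 + q_n for k = 3, and
q_n for k = 1.

The expansion of q_n comes from the recursion n q_n = ∑ 2 p_r q_{n-r} over odd r
(`natCast_smul_qSeries`), which the coefficients 2^ℓ / z also satisfy. As q_1 = 2 p_1 and q_2 = 2
p_1^2, the two products multiply these coefficients by m and m(m-1)/2, where m = m_1. The total
factor m(m-1)/2 - m + 1 = (m-1)(m-2)/2 is nonnegative for every natural m. -/

namespace SchurQ

open Finset

/-! ### The one-row functions `q_n` and power sums -/

/-- The one-row Schur `Q`-function `q_n`: the coefficient of `x ^ c` is `2 ^ #supp c`. -/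
noncomputable def qSeries (n : ℕ) : MvPowerSeries ℕ+ ℚ :=
  fun c => if c.degree = n then 2 ^ #c.support else 0

theorem coeff_qSeries (n : ℕ) (c : ℕ+ →₀ ℕ) :
    MvPowerSeries.coeff c (qSeries n) = if c.degree = n then 2 ^ #c.support else 0 := rfl

open Classical in
theorem coeff_powerSum (r : ℕ) (c : ℕ+ →₀ ℕ) :
    MvPowerSeries.coeff c (powerSum r) = if ∃ i : ℕ+, c = Finsupp.single i r then 1 else 0 := rfl

/-- For r > 0 the monomials x_i ^ r are distinct, so each i contributes exactly one splitting of c.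
-/
theorem coeff_powerSum_mul {r : ℕ} (hr : 0 < r) (f : MvPowerSeries ℕ+ ℚ) (c : ℕ+ →₀ ℕ) :
    MvPowerSeries.coeff c (powerSum r * f) =
      ∑ i ∈ c.support with r ≤ c i, MvPowerSeries.coeff (c - Finsupp.single i r) f := by
  classical
  rw [MvPowerSeries.coeff_mul]
  symm
  refine Finset.sum_of_injOn (fun i => (Finsupp.single i r, c - Finsupp.single i r)) ?_ ?_ ?_ ?_
  · intro i _ j _ hij
    exact Finsupp.single_left_injective hr.ne' (congrArg Prod.fst hij)
  · intro i hi
    replace hi := (mem_filter.1 (mem_coe.1 hi)).2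
    rw [mem_coe, HasAntidiagonal.mem_antidiagonal]
    exact add_tsub_cancel_of_le (Finsupp.single_le_iff.2 hi)
  · rintro ⟨a, b⟩ hab hn
    rw [HasAntidiagonal.mem_antidiagonal] at hab
    rw [coeff_powerSum, if_neg, zero_mul]
    rintro ⟨i, rfl⟩
    refine hn ⟨i, ?_, ?_⟩
    · simp only at hab
      subst hab
      rw [mem_coe, mem_filter]
      simp [hr.ne']
    · simp only at hab
      subst hab
      simp
  · intro i _
    rw [coeff_powerSum, if_pos ⟨i, rfl⟩, one_mul]

/-- The contribution of a single variable with exponent m to the recursion for q_n. -/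
theorem sum_odd_ite (m : ℕ) :
    ∑ r ∈ range (m + 1) with Odd r, (if r = m then (1 : ℚ) else 2) = m := by
  have key : ∀ m : ℕ, ∑ r ∈ range m with Odd r, (2 : ℚ) = if Odd m then (m : ℚ) - 1 else m := by
    intro m
    induction m with
    | zero => simp
    | succ m ih =>
      rw [sum_filter] at ih ⊢
      rw [sum_range_succ, ih]
      by_cases h : Odd m
      · simp only [h, if_true, Nat.odd_add_one, not_true, if_false]
        push_cast
        ring
      · simp only [h, if_false, Nat.odd_add_one, not_false_eq_true, if_true]
        push_cast
        ring
  have h2 := key m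
  rw [sum_filter] at h2 ⊢
  rw [sum_range_succ, if_pos rfl]
  have : ∑ r ∈ range m, (if Odd r then (if r = m then (1 : ℚ) else 2) else 0) =
      ∑ r ∈ range m, if Odd r then (2 : ℚ) else 0 :=
    sum_congr rfl fun r hr => by rw [if_neg (mem_range.1 hr).ne]
  rw [this, h2]
  split_ifs <;> ring

theorem degree_sub_single {c : ℕ+ →₀ ℕ} {i : ℕ+} {r : ℕ} (h : r ≤ c i) :
    (c - Finsupp.single i r).degree + r = c.degree := by
  conv_rhs => rw [← tsub_add_cancel_of_le (Finsupp.single_le_iff.2 h)]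
  rw [map_add, Finsupp.degree_single]

theorem two_mul_two_pow_card_support_sub_single {c : ℕ+ →₀ ℕ} {i : ℕ+} {r : ℕ} (hr : 0 < r)
    (h : r ≤ c i) : 2 * (2 : ℚ) ^ #(c - Finsupp.single i r).support =
      (if r = c i then 1 else 2) * 2 ^ #c.support := by
  classical
  split_ifs with hc
  · have : (c - Finsupp.single i r).support = c.support.erase i := by
      ext j
      by_cases hj : j = i
      · subst hj; simp [hc]
      · simp [hj]
    rw [this, one_mul, ← pow_succ', card_erase_add_one]
    rw [Finsupp.mem_support_iff]
    omega
  · have : (c - Finsupp.single i r).support = c.support := by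
      ext j
      by_cases hj : j = i
      · subst hj; simp; omega
      · simp [Ne.symm hj]
    rw [this]

/-- This is the logarithmic derivative of ∏ (1 + x_i t) / (1 - x_i t), checked coefficientwise:
removing x_i ^ r halves 2 ^ #supp exactly when it exhausts x_i, so variable i contributes its
exponent, and the exponents add up to n. -/
theorem natCast_smul_qSeries (n : ℕ) :
    (n : ℚ) • qSeries n =
      ∑ r ∈ range (n + 1) with Odd r, (2 : ℚ) • (powerSum r * qSeries (n - r)) := by
  ext c
  rw [map_sum, MvPowerSeries.coeff_smul, coeff_qSeries]
  have step : ∀ r ∈ (range (n + 1)).filter Odd,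
      MvPowerSeries.coeff c ((2 : ℚ) • (powerSum r * qSeries (n - r))) =
        if c.degree = n then ∑ i ∈ c.support with r ≤ c i,
          (if r = c i then 1 else 2) * 2 ^ #c.support else 0 := by
    intro r hr
    rw [mem_filter, mem_range] at hr
    rw [MvPowerSeries.coeff_smul, coeff_powerSum_mul hr.2.pos, Finset.mul_sum]
    split_ifs with hc
    · refine sum_congr rfl fun i hi => ?_
      have hi := (mem_filter.1 hi).2
      have := degree_sub_single hi
      rw [coeff_qSeries, if_pos (by omega),
        two_mul_two_pow_card_support_sub_single hr.2.pos hi]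
    · refine sum_eq_zero fun i hi => ?_
      have hi := (mem_filter.1 hi).2
      have := degree_sub_single hi
      rw [coeff_qSeries, if_neg (by omega), mul_zero]
  rw [sum_congr rfl step]
  split_ifs with hc
  · simp_rw [sum_filter]
    simp_rw [← sum_filter Odd]
    rw [sum_comm]
    have : ∀ i ∈ c.support, ∑ r ∈ range (n + 1) with Odd r,
        (if r ≤ c i then (if r = c i then (1 : ℚ) else 2) * 2 ^ #c.support else 0) =
          c i * 2 ^ #c.support := by
      intro i _
      rw [← sum_filter, filter_filter, ← sum_mul, ← sum_odd_ite (c i)]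
      congr 1
      refine sum_congr ?_ fun _ _ => rfl
      have := Finsupp.le_degree i c
      ext r
      simp only [mem_filter, mem_range]
      constructor
      · rintro ⟨_, h, _⟩; exact ⟨by omega, h⟩
      · rintro ⟨_, h⟩; exact ⟨by omega, h, by omega⟩
    rw [sum_congr rfl this, ← sum_mul, ← hc, Finsupp.degree_apply]
    push_cast
    rfl
  · simp

/-! ### Expansions over partitions into odd parts -/

/-- The linear combination of the `p_la`, `la` in `OP(n)`, with coefficients `g la`. -/
noncomputable def oddPartSeries (n : ℕ) (g : Multiset ℕ → ℚ) : MvPowerSeries ℕ+ ℚ :=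
  ∑ la ∈ Nat.Partition.odds n, g la.parts • powerSumPart la

theorem mem_odds {n : ℕ} {la : n.Partition} :
    la ∈ Nat.Partition.odds n ↔ ∀ i ∈ la.parts, Odd i := by
  simp [Nat.Partition.odds, Nat.Partition.restricted]

/-- Inserting a part r is a bijection onto the odd partitions that contain r. -/
theorem powerSum_mul_oddPartSeries {r : ℕ} (hr : Odd r) (m : ℕ) (g : Multiset ℕ → ℚ) :
    powerSum r * oddPartSeries m g =
      oddPartSeries (m + r) fun s => if r ∈ s then g (s.erase r) else 0 := by
  unfold oddPartSeries
  simp_rw [ite_smul, zero_smul]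
  rw [← sum_filter, mul_sum]
  refine sum_bij (fun la _ => ⟨r ::ₘ la.parts, ?_, ?_⟩) ?_ ?_ ?_ ?_
  · intro i hi
    rcases Multiset.mem_cons.1 hi with rfl | hi
    · exact hr.pos
    · exact la.parts_pos hi
  · rw [Multiset.sum_cons, la.parts_sum, add_comm]
  · intro la hla
    rw [mem_odds] at hla
    rw [mem_filter, mem_odds]
    refine ⟨fun i hi => ?_, Multiset.mem_cons_self _ _⟩
    rcases Multiset.mem_cons.1 hi with rfl | hi
    · exact hr
    · exact hla i hi
  · intro la _ mu _ h
    exact Nat.Partition.ext ((Multiset.cons_inj_right r).1 (congrArg Nat.Partition.parts h))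
  · intro la hla
    rw [mem_filter, mem_odds] at hla
    refine ⟨⟨la.parts.erase r, fun hi => la.parts_pos (Multiset.mem_of_mem_erase hi), ?_⟩, ?_, ?_⟩
    · have h1 := la.parts_sum
      rw [← Multiset.cons_erase hla.2, Multiset.sum_cons] at h1
      omega
    · rw [mem_odds]
      exact fun i hi => hla.1 i (Multiset.mem_of_mem_erase hi)
    · exact Nat.Partition.ext (Multiset.cons_erase hla.2)
  · intro la _
    simp only [Multiset.erase_cons_head, powerSumPart, Multiset.map_cons, Multiset.prod_cons,
      mul_smul_comm]

/-- The coefficient `z_s⁻¹ 2 ^ ℓ(s)` of `p_s` in `q_n`. -/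
def qCoeff (s : Multiset ℕ) : ℚ :=
  ((∏ i ∈ s.toFinset, i ^ s.count i * (s.count i).factorial : ℕ) : ℚ)⁻¹ * 2 ^ s.card

theorem prod_zee_cons (r : ℕ) (t : Multiset ℕ) :
    ∏ i ∈ (r ::ₘ t).toFinset, i ^ (r ::ₘ t).count i * ((r ::ₘ t).count i).factorial =
      r * (t.count r + 1) * ∏ i ∈ t.toFinset, i ^ t.count i * (t.count i).factorial := by
  have h : ∏ i ∈ t.toFinset, i ^ t.count i * (t.count i).factorial =
      ∏ i ∈ (r ::ₘ t).toFinset, i ^ t.count i * (t.count i).factorial := by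
    refine prod_subset ?_ ?_
    · simp
    · intro i _ hi
      rw [Multiset.mem_toFinset] at hi
      simp [Multiset.count_eq_zero_of_notMem hi]
  have hr : r ∈ (r ::ₘ t).toFinset := by simp
  rw [h, ← mul_prod_erase _ _ hr, ← mul_prod_erase _ _ hr, Multiset.count_cons_self, ← mul_assoc]
  congr 1
  · rw [pow_succ, Nat.factorial_succ]; ring
  · refine prod_congr rfl fun i hi => ?_
    rw [Multiset.count_cons_of_ne (ne_of_mem_erase hi)]

/-- Deleting a part r divides z by r m_r and lowers the length by one. -/
theorem two_mul_qCoeff_erase {r : ℕ} (hr : 0 < r) {s : Multiset ℕ} (hs : r ∈ s) :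
    2 * qCoeff (s.erase r) = r * s.count r * qCoeff s := by
  obtain ⟨t, rfl⟩ := Multiset.exists_cons_of_mem hs
  rw [Multiset.erase_cons_head]
  unfold qCoeff
  rw [prod_zee_cons, Multiset.card_cons, Multiset.count_cons_self]
  push_cast
  rw [mul_inv, pow_succ]
  have : (r : ℚ) ≠ 0 := by positivity
  have : (t.count r : ℚ) + 1 ≠ 0 := by positivity
  field_simp

theorem smul_oddPartSeries (n : ℕ) (a : ℚ) (g : Multiset ℕ → ℚ) :
    a • oddPartSeries n g = oddPartSeries n fun s => a * g s := by
  simp_rw [oddPartSeries, smul_sum, smul_smul]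

theorem oddPartSeries_add (n : ℕ) (g h : Multiset ℕ → ℚ) :
    oddPartSeries n g + oddPartSeries n h = oddPartSeries n fun s => g s + h s := by
  simp_rw [oddPartSeries, ← sum_add_distrib, add_smul]

theorem oddPartSeries_congr {n : ℕ} {g h : Multiset ℕ → ℚ}
    (H : ∀ s : Multiset ℕ, s.sum = n → (∀ i ∈ s, Odd i) → g s = h s) :
    oddPartSeries n g = oddPartSeries n h :=
  sum_congr rfl fun la hla => by rw [H la.parts la.parts_sum (mem_odds.1 hla)]

theorem two_smul_powerSum_mul_qCoeff {r : ℕ} (hr : Odd r) (m : ℕ) :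
    (2 : ℚ) • (powerSum r * oddPartSeries m qCoeff) =
      oddPartSeries (m + r) fun s => r * s.count r * qCoeff s := by
  rw [powerSum_mul_oddPartSeries hr, smul_oddPartSeries]
  refine oddPartSeries_congr fun s _ _ => ?_
  split_ifs with h
  · exact two_mul_qCoeff_erase hr.pos h
  · simp [Multiset.count_eq_zero_of_notMem h]

theorem sum_odd_mul_count {n : ℕ} {s : Multiset ℕ} (hs : s.sum = n) (ho : ∀ i ∈ s, Odd i) :
    ∑ r ∈ range (n + 1) with Odd r, ((r : ℚ) * s.count r) = n := by
  have h1 : (s.sum : ℚ) = ∑ r ∈ s.toFinset, ((r : ℚ) * s.count r) := by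
    rw [Finset.sum_multiset_count]
    push_cast
    refine sum_congr rfl fun i _ => ?_
    simp [mul_comm]
  rw [← hs, h1]
  symm
  refine sum_subset ?_ ?_
  · intro i hi
    rw [Multiset.mem_toFinset] at hi
    rw [mem_filter, mem_range]
    exact ⟨Nat.lt_succ_of_le (Multiset.le_sum_of_mem hi), ho i hi⟩
  · intro i _ hi
    rw [Multiset.mem_toFinset] at hi
    simp [Multiset.count_eq_zero_of_notMem hi]

theorem qSeries_zero : qSeries 0 = 1 := by
  ext c
  rw [coeff_qSeries, MvPowerSeries.coeff_one]
  by_cases h : c = 0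
  · simp [h]
  · rw [if_neg h, if_neg (by rwa [Finsupp.degree_eq_zero_iff])]

theorem oddPartSeries_zero : oddPartSeries 0 qCoeff = 1 := by
  have hp : ∀ la : Nat.Partition 0, la.parts = 0 := fun la => by
    rw [Subsingleton.elim la default]; rfl
  have : Nat.Partition.odds 0 = {default} := by
    ext la
    rw [mem_odds, hp]
    simp [Subsingleton.elim la default]
  rw [oddPartSeries, this, sum_singleton, powerSumPart, hp]
  simp [qCoeff]

/-- `q_n = ∑ z_la⁻¹ 2 ^ ℓ(la) p_la` over the partitions of `n` into odd parts. -/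
theorem qSeries_eq_oddPartSeries (n : ℕ) : qSeries n = oddPartSeries n qCoeff := by
  induction n using Nat.strong_induction_on with
  | _ n ih =>
    rcases Nat.eq_zero_or_pos n with rfl | hn
    · rw [qSeries_zero, oddPartSeries_zero]
    have hn' : (n : ℚ) ≠ 0 := by positivity
    refine smul_right_injective _ hn' ?_
    change (n : ℚ) • qSeries n = (n : ℚ) • oddPartSeries n qCoeff
    rw [natCast_smul_qSeries]
    have step : ∀ r ∈ (range (n + 1)).filter Odd,
        (2 : ℚ) • (powerSum r * qSeries (n - r)) =
          oddPartSeries n fun s => r * s.count r * qCoeff s := by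
      intro r hr
      rw [mem_filter, mem_range] at hr
      have := hr.2.pos
      rw [ih (n - r) (by omega), two_smul_powerSum_mul_qCoeff hr.2,
        Nat.sub_add_cancel (by omega)]
    -- Each r contributes r m_r times the coefficient, and ∑ r m_r = n.
    rw [sum_congr rfl step]
    simp_rw [oddPartSeries, smul_sum]
    rw [sum_comm]
    refine sum_congr rfl fun la hla => ?_
    rw [← sum_smul, ← sum_mul, sum_odd_mul_count la.parts_sum (mem_odds.1 hla), smul_smul]

/-! ### Multiplication by q_1 and q_2 -/

theorem two_smul_powerSum_one : (2 : ℚ) • powerSum 1 = qSeries 1 := by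
  have := two_smul_powerSum_mul_qCoeff odd_one 0
  rw [oddPartSeries_zero, mul_one, zero_add] at this
  rw [this, qSeries_eq_oddPartSeries]
  refine oddPartSeries_congr fun s hs ho => ?_
  have := sum_odd_mul_count hs ho
  rw [sum_filter, sum_range_succ, sum_range_one] at this
  simp at this
  simp [this]

theorem qSeries_two : qSeries 2 = (2 : ℚ) • (powerSum 1 * powerSum 1) := by
  have h := natCast_smul_qSeries 2
  have h2 : (range (2 + 1)).filter Odd = {1} := by decide
  rw [h2, sum_singleton] at h
  refine smul_right_injective _ (two_ne_zero (α := ℚ)) ?_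
  change (2 : ℚ) • qSeries 2 = (2 : ℚ) • (2 : ℚ) • (powerSum 1 * powerSum 1)
  rw [show ((2 : ℕ) : ℚ) = 2 by norm_num] at h
  rw [h, ← two_smul_powerSum_one, mul_smul_comm]

theorem qSeries_alternating_eq (m : ℕ) :
    qSeries (m + 1) * qSeries 2 - qSeries (m + 2) * qSeries 1 + qSeries (m + 3) =
      oddPartSeries (m + 3) fun s =>
        if s.count 1 = 0 then qCoeff s
        else if s.count 1 = 1 ∨ s.count 1 = 2 then 0
        else ((s.count 1 - 1).choose 2 : ℚ) * qCoeff s := by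
  have h1 : qSeries (m + 2) * qSeries 1 =
      oddPartSeries (m + 3) fun s => s.count 1 * qCoeff s := by
    rw [← two_smul_powerSum_one, mul_comm, smul_mul_assoc, qSeries_eq_oddPartSeries,
      two_smul_powerSum_mul_qCoeff odd_one]
    refine oddPartSeries_congr fun s _ _ => ?_
    simp
  have h2 : qSeries (m + 1) * qSeries 2 =
      oddPartSeries (m + 3) fun s => s.count 1 * (s.count 1 - 1) / 2 * qCoeff s := by
    -- Of the two factors p_1 in q_2 = 2 p_1^2, only the first to be applied absorbs the 2; the
    -- other leaves the denominator 2.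
    rw [qSeries_two, mul_comm, smul_mul_assoc, mul_assoc, ← mul_smul_comm,
      qSeries_eq_oddPartSeries, two_smul_powerSum_mul_qCoeff odd_one,
      powerSum_mul_oddPartSeries odd_one]
    refine oddPartSeries_congr fun s _ _ => ?_
    split_ifs with h
    · have h3 := two_mul_qCoeff_erase one_pos h
      have h4 := Multiset.count_erase_self 1 s
      have h5 := Multiset.count_pos.2 h
      have h6 : ((s.erase 1).count 1 : ℚ) = s.count 1 - 1 := by
        rw [h4, Nat.cast_sub h5]; simp
      rw [h6]
      push_cast at h3 ⊢
      linear_combination ((s.count 1 : ℚ) - 1) / 2 * h3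
    · simp [Multiset.count_eq_zero_of_notMem h]
  rw [h1, h2, qSeries_eq_oddPartSeries, sub_eq_add_neg, ← neg_one_smul ℚ, smul_oddPartSeries,
    oddPartSeries_add, oddPartSeries_add]
  refine oddPartSeries_congr fun s _ _ => ?_
  split_ifs with h h'
  · simp [h]
  · rcases h' with h' | h' <;> rw [h'] <;> ring
  · obtain ⟨k, hk⟩ : ∃ k, s.count 1 = k + 1 := ⟨s.count 1 - 1, by omega⟩
    rw [hk, Nat.add_sub_cancel, Nat.cast_choose_two]
    push_cast
    ring

end SchurQ

namespace SchurQ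

open Finset

/-! ### Generating functions of words -/

section Words

variable {ι κ : Type*} [Fintype ι] [Fintype κ]

/-- The content of a word: the number of `i` and `i'` in it, for each `i`. -/
noncomputable def wordContent (w : ι → Letter) : ℕ+ →₀ ℕ :=
  ∑ i, Finsupp.single (w i).abs 1

theorem finite_wordContent_eq (P : (ι → Letter) → Prop) (c : ℕ+ →₀ ℕ) :
    Finite {w : ι → Letter // P w ∧ wordContent w = c} := by
  have key : ∀ w : {w : ι → Letter // P w ∧ wordContent w = c}, ∀ i,
      (w.1 i).abs ∈ c.support := by
    rintro ⟨w, -, rfl⟩ i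
    rw [Finsupp.mem_support_iff]
    intro h0
    unfold wordContent at h0
    rw [Finsupp.finsetSum_apply, Finset.sum_eq_zero_iff] at h0
    simpa using h0 i (Finset.mem_univ i)
  let f : {w : ι → Letter // P w ∧ wordContent w = c} → (ι → c.support × Bool) :=
    fun w i => (⟨(w.1 i).abs, key w i⟩, (ofLex (w.1 i)).2)
  refine Finite.of_injective f ?_
  rintro ⟨w, h⟩ ⟨w', h'⟩ hf
  refine Subtype.ext (funext fun i => ?_)
  have hb := congrFun hf i
  simp only [f, Prod.mk.injEq, Subtype.mk.injEq] at hb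
  exact ofLex.injective (Prod.ext hb.1 hb.2)

theorem degree_wordContent (w : ι → Letter) : (wordContent w).degree = Fintype.card ι := by
  simp [wordContent, map_sum]

/-- The generating function `∑ x ^ c(w)` over all words `w` that satisfy `P`. -/
noncomputable def wordSeries (P : (ι → Letter) → Prop) : MvPowerSeries ℕ+ ℚ :=
  fun c => (Nat.card {w : ι → Letter // P w ∧ wordContent w = c} : ℚ)

theorem coeff_wordSeries (P : (ι → Letter) → Prop) (c : ℕ+ →₀ ℕ) :
    MvPowerSeries.coeff c (wordSeries P) =
      (Nat.card {w : ι → Letter // P w ∧ wordContent w = c} : ℚ) := rfl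

theorem wordContent_comp (e : κ ≃ ι) (w : ι → Letter) : wordContent (w ∘ e) = wordContent w :=
  Equiv.sum_comp e fun i => Finsupp.single (w i).abs 1

theorem wordSeries_comp (e : κ ≃ ι) (P : (κ → Letter) → Prop) :
    wordSeries (fun w : ι → Letter => P (w ∘ e)) = wordSeries P := by
  ext c
  rw [coeff_wordSeries, coeff_wordSeries]
  congr 1
  refine Nat.card_congr ((e.symm.arrowCongr (Equiv.refl Letter)).subtypeEquiv fun w => ?_)
  have : (e.symm.arrowCongr (Equiv.refl Letter)) w = w ∘ e := rfl
  rw [this, wordContent_comp]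

theorem wordSeries_add_of_disjoint {P Q R : (ι → Letter) → Prop} (hd : ∀ w, Q w → ¬ R w)
    (h : ∀ w, P w ↔ Q w ∨ R w) : wordSeries P = wordSeries Q + wordSeries R := by
  classical
  ext c
  rw [map_add, coeff_wordSeries, coeff_wordSeries, coeff_wordSeries]
  have := finite_wordContent_eq Q c
  have := finite_wordContent_eq R c
  rw [← Nat.cast_add, ← Nat.card_sum]
  congr 1
  refine Nat.card_congr ((Equiv.subtypeEquivRight fun w => ?_).trans
    (subtypeOrEquiv (fun w => Q w ∧ wordContent w = c) (fun w => R w ∧ wordContent w = c) ?_))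
  · rw [h, or_and_right]
  · rw [Pi.disjoint_iff]
    intro w
    rw [Prop.disjoint_iff]
    by_contra hw
    tauto

/-- A word on a disjoint union is a pair of words, and contents add; the contents of the two halves
pick the term of the antidiagonal. -/
theorem wordSeries_mul (P : (ι → Letter) → Prop) (Q : (κ → Letter) → Prop) :
    wordSeries P * wordSeries Q =
      wordSeries fun w : ι ⊕ κ → Letter => P (w ∘ Sum.inl) ∧ Q (w ∘ Sum.inr) := by
  classical
  ext c
  rw [MvPowerSeries.coeff_mul, coeff_wordSeries]
  simp_rw [coeff_wordSeries, ← Nat.cast_mul, ← Nat.card_prod]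
  rw [← Nat.cast_sum, ← Finset.sum_coe_sort]
  have h1 := finite_wordContent_eq P
  have h2 := finite_wordContent_eq Q
  rw [← Nat.card_sigma]
  congr 1
  have hc : ∀ w : ι ⊕ κ → Letter,
      wordContent w = wordContent (w ∘ Sum.inl) + wordContent (w ∘ Sum.inr) := fun w =>
    Fintype.sum_sum_type _
  symm
  refine Nat.card_congr
    { toFun := fun w => ⟨⟨(wordContent (w.1 ∘ Sum.inl), wordContent (w.1 ∘ Sum.inr)),
        HasAntidiagonal.mem_antidiagonal.2 ((hc w.1).symm.trans w.2.2)⟩,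
        ⟨w.1 ∘ Sum.inl, w.2.1.1, rfl⟩, ⟨w.1 ∘ Sum.inr, w.2.1.2, rfl⟩⟩
      invFun := fun u => ⟨Sum.elim u.2.1.1 u.2.2.1, ⟨u.2.1.2.1, u.2.2.2.1⟩, ?_⟩
      left_inv := fun w => Subtype.ext (Sum.elim_comp_inl_inr w.1)
      right_inv := ?_ }
  · rw [hc, Sum.elim_comp_inl, Sum.elim_comp_inr, u.2.1.2.2, u.2.2.2.2]
    exact HasAntidiagonal.mem_antidiagonal.1 u.1.2
  · rintro ⟨⟨⟨a, b⟩, hab⟩, ⟨u, hu, hu'⟩, ⟨v, hv, hv'⟩⟩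
    simp only at hu' hv'
    subst hu' hv'
    rfl

end Words

/-! ### Hook words -/

/-- `x < y`, or `x = y` is a letter of the kind `b` that may be repeated. -/
def Follows (b : Bool) (x y : Letter) : Prop := x < y ∨ (x = y ∧ (ofLex x).2 = b)

theorem Follows.trans {b : Bool} {x y z : Letter} (h : Follows b x y) (h' : Follows b y z) :
    Follows b x z := by
  rcases h with h | ⟨rfl, h⟩
  · rcases h' with h' | ⟨rfl, h'⟩
    · exact Or.inl (h.trans h')
    · exact Or.inl h
  · exact h'

theorem Follows.le {b : Bool} {x y : Letter} (h : Follows b x y) : x ≤ y := by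
  rcases h with h | ⟨rfl, h⟩
  · exact h.le
  · exact le_rfl

/-- Equal letters are either unmarked (repeatable in a row) or marked (repeatable in a column). This
dichotomy drives the telescoping. -/
theorem not_follows_true {x y : Letter} : ¬ Follows true x y ↔ Follows false y x := by
  unfold Follows
  rcases lt_trichotomy x y with h | rfl | h
  · simp [h, h.not_gt, h.ne']
  · simp
  · simp [h, h.not_gt, h.ne']

/-- Words that go along a row on the indices below `a` and up a column on those from `b` on. -/
def IsHookWord {n : ℕ} (a b : ℕ) (w : Fin n → Letter) : Prop :=
  (∀ i j : Fin n, i < j → j.1 < a → Follows true (w i) (w j)) ∧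
    ∀ i j : Fin n, i < j → b ≤ i.1 → Follows false (w j) (w i)

/-- The letters at a - 1 and a, on either side of the cut, decide whether the row grows by one box
or the column does; transitivity extends the comparison to all other letters. -/
theorem isHookWord_iff {n a : ℕ} (ha : 0 < a) (han : a < n) (w : Fin n → Letter) :
    IsHookWord a a w ↔ IsHookWord (a + 1) a w ∨ IsHookWord a (a - 1) w := by
  constructor
  · rintro ⟨h1, h2⟩
    by_cases h : Follows true (w ⟨a - 1, by omega⟩) (w ⟨a, han⟩)
    · refine Or.inl ⟨fun i j hij hj => ?_, h2⟩
      rcases Nat.lt_or_ge j.1 a with hj' | hj'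
      · exact h1 i j hij hj'
      obtain rfl : j = ⟨a, han⟩ := Fin.ext (by simp only; omega)
      rw [Fin.lt_def] at hij
      simp only at hij
      rcases Nat.lt_or_ge i.1 (a - 1) with hi | hi
      · exact (h1 i ⟨a - 1, by omega⟩ hi (by simp only; omega)).trans h
      · have hia : i = ⟨a - 1, by omega⟩ := Fin.ext (by simp only; omega)
        rwa [hia]
    · rw [not_follows_true] at h
      refine Or.inr ⟨h1, fun i j hij hi => ?_⟩
      rcases Nat.lt_or_ge i.1 a with hi' | hi'
      · have hia : i = ⟨a - 1, by omega⟩ := Fin.ext (by simp only; omega)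
        rw [Fin.lt_def] at hij
        rw [hia]
        rcases Nat.lt_or_ge a j.1 with hj | hj
        · exact (h2 ⟨a, han⟩ j hj le_rfl).trans h
        · obtain rfl : j = ⟨a, han⟩ := Fin.ext (by simp only; omega)
          exact h
      · exact h2 i j hij hi'
  · rintro (⟨h1, h2⟩ | ⟨h1, h2⟩)
    · exact ⟨fun i j hij hj => h1 i j hij (by omega), h2⟩
    · exact ⟨h1, fun i j hij hj => h2 i j hij (by omega)⟩

theorem wordSeries_isHookWord_eq_add {n a : ℕ} (ha : 0 < a) (han : a < n) :
    wordSeries (IsHookWord (n := n) a a) =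
      wordSeries (IsHookWord (n := n) (a + 1) a) + wordSeries (IsHookWord (n := n) a (a - 1)) := by
  refine wordSeries_add_of_disjoint (fun w hw hw' => ?_) (isHookWord_iff ha han)
  have h1 := hw.1 ⟨a - 1, by omega⟩ ⟨a, han⟩ (by rw [Fin.lt_def]; simp only; omega)
    (by simp only; omega)
  have h2 := hw'.2 ⟨a - 1, by omega⟩ ⟨a, han⟩ (by rw [Fin.lt_def]; simp only; omega) le_rfl
  exact not_follows_true.2 h2 h1

theorem wordSeries_isHookWord_self (a b : ℕ) :
    wordSeries (IsHookWord (n := a + b) a a) =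
      wordSeries (fun w : Fin a → Letter => ∀ i j, i < j → Follows true (w i) (w j)) *
        wordSeries (fun w : Fin b → Letter => ∀ i j, i < j → Follows false (w j) (w i)) := by
  rw [wordSeries_mul, ← wordSeries_comp finSumFinEquiv]
  congr 1
  ext w
  constructor
  · rintro ⟨h1, h2⟩
    exact ⟨fun i j hij => h1 (Fin.castAdd b i) (Fin.castAdd b j) hij j.2,
      fun i j hij => h2 (Fin.natAdd a i) (Fin.natAdd a j) (Nat.add_lt_add_left hij a)
        (Nat.le_add_right _ _)⟩
  · rintro ⟨h1, h2⟩
    refine ⟨fun i j hij hj => ?_, fun i j hij hi => ?_⟩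
    · rw [Fin.lt_def] at hij
      exact h1 ⟨i, hij.trans hj⟩ ⟨j, hj⟩ hij
    · rw [Fin.lt_def] at hij
      obtain ⟨i, rfl⟩ : ∃ k, i = Fin.natAdd a k :=
        ⟨⟨i - a, by omega⟩, Fin.ext (by simp only [Fin.val_natAdd]; omega)⟩
      obtain ⟨j, rfl⟩ : ∃ k, j = Fin.natAdd a k :=
        ⟨⟨j - a, by omega⟩, Fin.ext (by simp only [Fin.val_natAdd]; omega)⟩
      exact h2 i j (by simpa using hij)

/-! ### Counting the words of a row or a column -/

theorem exists_monotone_map_eq {α : Type*} [LinearOrder α] {n : ℕ} {M : Multiset α}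
    (hM : M.card = n) : ∃ w : Fin n → α, Monotone w ∧ univ.val.map w = M := by
  subst hM
  refine ⟨fun i => (M.sort).get (i.cast (Multiset.length_sort _).symm), fun i j hij => ?_, ?_⟩
  · rcases hij.eq_or_lt with rfl | hij
    · exact le_rfl
    · exact List.pairwise_iff_get.1 (Multiset.pairwise_sort M _) _ _ hij
  · rw [Fin.univ_val_map]
    conv_rhs => rw [← Multiset.sort_eq M (· ≤ ·)]
    congr 1
    refine List.ext_getElem (by simp) ?_
    intro i h1 h2
    simp

theorem monotone_eq_of_map_eq {α : Type*} [LinearOrder α] {n : ℕ} {w w' : Fin n → α}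
    (hw : Monotone w) (hw' : Monotone w') (h : univ.val.map w = univ.val.map w') : w = w' := by
  rw [Fin.univ_val_map, Fin.univ_val_map, Multiset.coe_eq_coe] at h
  refine List.ofFn_injective (h.eq_of_pairwise' ?_ ?_ (r := (· ≤ ·)))
  · exact List.pairwise_ofFn.2 fun i j hij => hw hij.le
  · exact List.pairwise_ofFn.2 fun i j hij => hw' hij.le

theorem wordContent_apply {ι : Type*} [Fintype ι] (w : ι → Letter) (b : Bool) (k : ℕ+) :
    wordContent w k = (univ.val.map w).count (toLex (k, b)) +
      (univ.val.map w).count (toLex (k, !b)) := by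
  classical
  have h : wordContent w k =
      ∑ i, ((if toLex (k, b) = w i then 1 else 0) + if toLex (k, !b) = w i then 1 else 0) := by
    rw [wordContent, Finsupp.finsetSum_apply]
    refine sum_congr rfl fun i _ => ?_
    obtain ⟨⟨m, d⟩, hm⟩ : ∃ x : ℕ+ × Bool, w i = toLex x := ⟨ofLex (w i), rfl⟩
    rw [hm, Finsupp.single_apply]
    change (if m = k then 1 else 0) = _
    simp only [EmbeddingLike.apply_eq_iff_eq, Prod.mk.injEq]
    cases b <;> cases d <;> simp [eq_comm]
  rw [h, sum_add_distrib, Multiset.count_map, Multiset.count_map, ← card_filter, ← card_filter]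
  rfl

/-- With `follows_of_monotone`, this turns the rule into a condition on the multiset of letters of a
monotone word. -/
theorem count_le_one_of_follows {n : ℕ} {b : Bool} {w : Fin n → Letter}
    (hw : ∀ i j, i < j → Follows b (w i) (w j)) (k : ℕ+) :
    (univ.val.map w).count (toLex (k, !b)) ≤ 1 := by
  classical
  rw [Multiset.count_map]
  change #(univ.filter fun i => toLex (k, !b) = w i) ≤ 1
  have key : ∀ i j, toLex (k, !b) = w i → toLex (k, !b) = w j → ¬ i < j := by
    intro i j hi hj hij
    rcases hw i j hij with h | ⟨-, h⟩
    · rw [← hi, ← hj] at h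
      exact lt_irrefl _ h
    · rw [← hi] at h
      simp at h
  rw [card_le_one]
  intro i hi j hj
  rw [mem_filter] at hi hj
  exact le_antisymm (not_lt.1 (key j i hj.2 hi.2)) (not_lt.1 (key i j hi.2 hj.2))

theorem follows_of_monotone {n : ℕ} {b : Bool} {w : Fin n → Letter} (hm : Monotone w)
    (hw : ∀ k : ℕ+, (univ.val.map w).count (toLex (k, !b)) ≤ 1) (i j : Fin n) (hij : i < j) :
    Follows b (w i) (w j) := by
  classical
  rcases (hm hij.le).lt_or_eq with h | h
  · exact Or.inl h
  refine Or.inr ⟨h, ?_⟩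
  by_contra hb
  have hi : toLex ((ofLex (w i)).1, !b) = w i := by
    refine ofLex.injective (Prod.ext rfl ?_)
    change (!b) = (ofLex (w i)).2
    revert hb
    cases b <;> cases (ofLex (w i)).2 <;> simp
  have h1 := hw (ofLex (w i)).1
  rw [Multiset.count_map] at h1
  change #(univ.filter fun l => toLex ((ofLex (w i)).1, !b) = w l) ≤ 1 at h1
  rw [card_le_one] at h1
  exact hij.ne (h1 i (by simp [hi]) j (by simp only [mem_filter, mem_univ, true_and]; rw [hi, h]))

/-- Such a word is the sorted list of its letters. Given c, the only freedom is, for each k in the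
support, whether the non-repeatable version of k occurs (then once). -/
theorem card_words_of_degree {n : ℕ} (b : Bool) {c : ℕ+ →₀ ℕ} (hc : c.degree = n) :
    Nat.card {w : Fin n → Letter // (∀ i j, i < j → Follows b (w i) (w j)) ∧ wordContent w = c} =
      2 ^ #c.support := by
  classical
  rw [← card_powerset, ← Nat.card_eq_finsetCard]
  refine Nat.card_eq_of_bijective
    (fun w => ⟨c.support.filter fun k => toLex (k, !b) ∈ univ.val.map w.1,
      mem_powerset.2 (filter_subset _ _)⟩) ⟨?_, ?_⟩
  · rintro ⟨w, hw, hwc⟩ ⟨w', hw', hwc'⟩ h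
    have hA := Finset.ext_iff.1 (congrArg Subtype.val h)
    refine Subtype.ext (monotone_eq_of_map_eq
      (monotone_iff_forall_lt.2 fun i j hij => (hw i j hij).le)
      (monotone_iff_forall_lt.2 fun i j hij => (hw' i j hij).le) ?_)
    have key : ∀ k, (univ.val.map w).count (toLex (k, !b)) =
        (univ.val.map w').count (toLex (k, !b)) := by
      intro k
      have h1 := count_le_one_of_follows hw k
      have h2 := count_le_one_of_follows hw' k
      have h3 := wordContent_apply w b k
      have h4 := wordContent_apply w' b k
      have h5 := hA k
      rw [hwc] at h3
      rw [hwc'] at h4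
      dsimp only at h5
      simp only [mem_filter, Finsupp.mem_support_iff, ← Multiset.count_pos] at h5
      omega
    ext x
    obtain ⟨⟨k, d⟩, rfl⟩ : ∃ y : ℕ+ × Bool, x = toLex y := ⟨ofLex x, rfl⟩
    by_cases hd : d = b
    · have h3 := wordContent_apply w b k
      have h4 := wordContent_apply w' b k
      rw [hwc] at h3
      rw [hwc'] at h4
      have := key k
      dsimp only
      rw [hd]
      omega
    · obtain rfl : d = !b := by revert hd; cases b <;> cases d <;> simp
      exact key k
  · rintro ⟨A, hA⟩
    rw [mem_powerset] at hA
    -- The letters of the word belonging to A: one non-repeatable copy of each k in A, all other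
    -- copies repeatable.
    let M : Multiset Letter := ∑ k ∈ c.support,
      (Multiset.replicate (c k - if k ∈ A then 1 else 0) (toLex (k, b)) +
        Multiset.replicate (if k ∈ A then 1 else 0) (toLex (k, !b)))
    have hb : b ≠ !b := by cases b <;> simp
    have hle : ∀ k ∈ c.support, (if k ∈ A then 1 else 0) ≤ c k := by
      intro k hk
      rw [Finsupp.mem_support_iff] at hk
      split_ifs <;> omega
    have hcount : ∀ k, M.count (toLex (k, b)) = c k - if k ∈ A then 1 else 0 := by
      intro k
      simp only [M, Multiset.count_sum', Multiset.count_add, Multiset.count_replicate,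
        EmbeddingLike.apply_eq_iff_eq, Prod.mk.injEq, hb.symm, and_true, and_false, if_false,
        add_zero, sum_ite_eq', Finsupp.mem_support_iff]
      split_ifs <;> omega
    have hcount' : ∀ k, M.count (toLex (k, !b)) = if k ∈ A then 1 else 0 := by
      intro k
      have := @hA k
      simp only [M, Multiset.count_sum', Multiset.count_add, Multiset.count_replicate,
        EmbeddingLike.apply_eq_iff_eq, Prod.mk.injEq, hb, and_true, and_false, if_false,
        zero_add, sum_ite_eq']
      split_ifs <;> tauto
    have hcard : M.card = n := by
      rw [← hc, Finsupp.degree_apply, Multiset.card_sum]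
      refine sum_congr rfl fun k hk => ?_
      rw [Multiset.card_add, Multiset.card_replicate, Multiset.card_replicate]
      have := hle k hk
      omega
    obtain ⟨w, hm, hw⟩ := exists_monotone_map_eq hcard
    refine ⟨⟨w, follows_of_monotone hm fun k => ?_, ?_⟩, Subtype.ext ?_⟩
    · rw [hw, hcount']
      split_ifs <;> simp
    · ext k
      rw [wordContent_apply w b, hw, hcount, hcount']
      by_cases hk : k ∈ c.support
      · exact Nat.sub_add_cancel (hle k hk)
      · rw [if_neg fun h => hk (hA h)]
        rfl
    · ext k
      simp only [mem_filter, hw, ← Multiset.count_pos, hcount']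
      have := @hA k
      split_ifs <;> simp_all

theorem wordSeries_follows (n : ℕ) (b : Bool) :
    wordSeries (fun w : Fin n → Letter => ∀ i j, i < j → Follows b (w i) (w j)) = qSeries n := by
  ext c
  rw [coeff_wordSeries, coeff_qSeries]
  split_ifs with h
  · rw [card_words_of_degree b h]
    norm_cast
  · have : IsEmpty {w : Fin n → Letter //
        (∀ i j, i < j → Follows b (w i) (w j)) ∧ wordContent w = c} := by
      refine ⟨fun w => h ?_⟩
      rw [← w.2.2, degree_wordContent, Fintype.card_fin]
    rw [Nat.card_of_isEmpty, Nat.cast_zero]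

theorem wordSeries_follows_rev (n : ℕ) (b : Bool) :
    wordSeries (fun w : Fin n → Letter => ∀ i j, i < j → Follows b (w j) (w i)) = qSeries n := by
  rw [← wordSeries_follows n b, ← wordSeries_comp Fin.revPerm]
  congr 1
  ext w
  constructor
  · intro h i j hij
    have := h j.rev i.rev (Fin.rev_lt_rev.2 hij)
    simpa only [Function.comp_apply, Fin.revPerm_apply, Fin.rev_rev] using this
  · exact fun h i j hij => h _ _ (Fin.rev_lt_rev.2 hij)

theorem qSeries_mul_qSeries (a b : ℕ) :
    qSeries a * qSeries b = wordSeries (IsHookWord (n := a + b) a a) := by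
  rw [wordSeries_isHookWord_self, wordSeries_follows, wordSeries_follows_rev]

/-- The column rule is vacuous here, as it covers a single index. -/
theorem wordSeries_isHookWord_row (m : ℕ) :
    wordSeries (IsHookWord (n := m + 1) (m + 1) m) = qSeries (m + 1) := by
  rw [← wordSeries_follows (m + 1) true]
  congr 1
  ext w
  refine ⟨fun h i j hij => h.1 i j hij j.2, fun h => ⟨fun i j hij _ => h i j hij, ?_⟩⟩
  intro i j hij hi
  rw [Fin.lt_def] at hij
  omega

/-- Two cuts, after m + 1 and m + 2 letters, share one hook series, which cancels; the remaining
unwanted one is a pure row. -/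
theorem wordSeries_isHookWord_three (m : ℕ) :
    wordSeries (IsHookWord (n := m + 3) (m + 1) m) =
      qSeries (m + 1) * qSeries 2 - qSeries (m + 2) * qSeries 1 + qSeries (m + 3) := by
  rw [qSeries_mul_qSeries, qSeries_mul_qSeries, ← wordSeries_isHookWord_row,
    wordSeries_isHookWord_eq_add (a := m + 1) (by omega) (by omega),
    wordSeries_isHookWord_eq_add (a := m + 2) (by omega) (by omega)]
  simp only [Nat.add_sub_cancel, show m + 2 - 1 = m + 1 from rfl]
  ring

end SchurQ

namespace SchurQ

open Finset

/-! ### Tableaux of the shape of `𝔯_{△_{n,k}}` as hook words -/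

theorem tableauSeries_eq_wordSeries (D : Finset (ℕ × ℕ)) :
    tableauSeries D =
      wordSeries fun w : D → Letter => ∃ T : MarkedShiftedTableau D, T.entry = w := by
  ext c
  rw [coeff_wordSeries]
  change (Nat.card {T : MarkedShiftedTableau D // T.content = c} : ℚ) = _
  congr 1
  refine Nat.card_eq_of_bijective (fun T => ⟨T.1.entry, ⟨T.1, rfl⟩, T.2⟩) ⟨?_, ?_⟩
  · rintro ⟨⟨w, _, _, _, _⟩, _⟩ ⟨⟨w', _, _, _, _⟩, _⟩ h
    obtain rfl : w = w' := congrArg Subtype.val h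
    rfl
  · rintro ⟨_, ⟨T, rfl⟩, hT⟩
    exact ⟨⟨T, hT⟩, rfl⟩

/-- The diagram of `𝔯_{△_{n,k}}`. -/
abbrev triangleDiagram (n k : ℕ) (hkn : k ≤ n) : Finset (ℕ × ℕ) :=
  shiftedSkewDiagram (staircase n k hkn)
    (staircase (n - 1) (k - 1) (Nat.sub_le_sub_right hkn 1)) (staircase_subset n k hkn)

theorem mem_triangleDiagram {n k : ℕ} (hk : 1 ≤ k) (hkn : k ≤ n) {d : ℕ × ℕ} :
    d ∈ triangleDiagram n k hkn ↔
      d.1 < k ∧ k ≤ d.2 + 1 ∧ d.2 < n ∧ (d.1 + 1 = k ∨ d.2 + 1 = n) := by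
  rw [mem_shiftedSkewDiagram, staircase_part, staircase_part]
  split_ifs <;> omega

/-- The boxes in their order along the hook, from the left end of its row to the top. -/
def triangleDiagramEquiv {n k : ℕ} (hk : 1 ≤ k) (hkn : k ≤ n) :
    triangleDiagram n k hkn ≃ Fin n where
  toFun d := ⟨d.1.2 - d.1.1, by
    have := (mem_triangleDiagram hk hkn).1 d.2
    omega⟩
  -- The corner has index n - k, where both formulas agree.
  invFun t := ⟨if t.1 ≤ n - k then (k - 1, k - 1 + t) else (n - 1 - t, n - 1), by
    have := t.2
    rw [mem_triangleDiagram hk hkn]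
    split_ifs <;> simp only <;> omega⟩
  left_inv := by
    rintro ⟨⟨i, j⟩, h⟩
    rw [mem_triangleDiagram hk hkn] at h
    simp only at h
    refine Subtype.ext ?_
    simp only
    split_ifs <;> simp only [Prod.mk.injEq] <;> omega
  right_inv := by
    intro t
    have := t.2
    refine Fin.ext ?_
    simp only
    split_ifs <;> simp only <;> omega

/-- The corner obeys both rules, so the two index ranges overlap in n - k. The column is read
upwards, which reverses its rule. -/
theorem exists_entry_eq_iff {n k : ℕ} (hk : 1 ≤ k) (hkn : k ≤ n)
    (w : triangleDiagram n k hkn → Letter) :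
    (∃ T : MarkedShiftedTableau (triangleDiagram n k hkn), T.entry = w) ↔
      IsHookWord (n - k + 1) (n - k) (w ∘ (triangleDiagramEquiv hk hkn).symm) := by
  have hv : ∀ d, ((triangleDiagramEquiv hk hkn) d).1 = d.1.2 - d.1.1 := fun _ => rfl
  have hD : ∀ d : triangleDiagram n k hkn, _ := fun d => (mem_triangleDiagram hk hkn).1 d.2
  unfold IsHookWord
  simp only [(triangleDiagramEquiv hk hkn).surjective.forall, Function.comp_apply,
    Equiv.symm_apply_apply, Fin.lt_def, hv]
  constructor
  · rintro ⟨T, rfl⟩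
    constructor
    · intro d d' h h'
      have hd := hD d
      have hd' := hD d'
      have hrow : d.1.1 = d'.1.1 := by omega
      rcases (T.row_weak d d' hrow (by omega)).lt_or_eq with hlt | heq
      · exact Or.inl hlt
      · refine Or.inr ⟨heq, ?_⟩
        by_contra hm
        have := T.row_marked d d' hrow heq (by simpa [Letter.IsMarked] using hm)
        rw [this] at h
        exact lt_irrefl _ h
    · intro d d' h h'
      have hd := hD d
      have hd' := hD d'
      have hcol : d'.1.2 = d.1.2 := by omega
      rcases (T.col_weak d' d hcol (by omega)).lt_or_eq with hlt | heq
      · exact Or.inl hlt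
      · refine Or.inr ⟨heq, ?_⟩
        by_contra hm
        have := T.col_unmarked d' d hcol heq hm
        rw [this] at h
        exact lt_irrefl _ h
  · rintro ⟨h1, h2⟩
    have hrow : ∀ d d' : triangleDiagram n k hkn, d.1.1 = d'.1.1 → d.1.2 < d'.1.2 →
        Follows true (w d) (w d') := by
      intro d d' h h'
      have hd := hD d
      have hd' := hD d'
      exact h1 d d' (by omega) (by omega)
    have hcol : ∀ d d' : triangleDiagram n k hkn, d.1.2 = d'.1.2 → d.1.1 < d'.1.1 →
        Follows false (w d) (w d') := by
      intro d d' h h'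
      have hd := hD d
      have hd' := hD d'
      exact h2 d' d (by omega) (by omega)
    have hext : ∀ d d' : triangleDiagram n k hkn, d.1.1 = d'.1.1 → d.1.2 = d'.1.2 → d = d' :=
      fun d d' h h' => Subtype.ext (Prod.ext h h')
    have hirr : ∀ {b : Bool} {x y : Letter}, Follows b x y → x = y → (ofLex x).2 = b := by
      rintro b x y (h | h) rfl
      · exact absurd h (lt_irrefl _)
      · exact h.2
    refine ⟨⟨w, ?_, ?_, ?_, ?_⟩, rfl⟩
    · intro d d' h h'
      rcases h'.lt_or_eq with h' | h'
      · exact (hrow d d' h h').le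
      · rw [hext d d' h h']
    · intro d d' h h'
      rcases h'.lt_or_eq with h' | h'
      · exact (hcol d d' h h').le
      · rw [hext d d' h' h]
    · intro d d' h hw hm
      rcases lt_trichotomy d.1.1 d'.1.1 with h' | h' | h'
      · exact absurd (hirr (hcol d d' h h') hw) hm
      · exact hext d d' h' h
      · rw [hw] at hm
        exact absurd (hirr (hcol d' d h.symm h') hw.symm) hm
    · intro d d' h hw hm
      rcases lt_trichotomy d.1.2 d'.1.2 with h' | h' | h'
      · have := hirr (hrow d d' h h') hw
        rw [Letter.IsMarked, this] at hm
        exact absurd hm (by simp)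
      · exact hext d d' h h'
      · have := hirr (hrow d' d h.symm h') hw.symm
        rw [Letter.IsMarked, hw, this] at hm
        exact absurd hm (by simp)

theorem triangleQ_eq_wordSeries (n k : ℕ) (hk : 1 ≤ k) (hkn : k ≤ n) :
    triangleQ n k hk hkn = wordSeries (IsHookWord (n := n) (n - k + 1) (n - k)) := by
  rw [triangleQ, skewSchurQ, tableauSeries_eq_wordSeries,
    ← wordSeries_comp (triangleDiagramEquiv hk hkn).symm]
  congr 1
  ext w
  exact exists_entry_eq_iff hk hkn w

/-! ### Positivity -/

theorem isPPositive_oddPartSeries (n : ℕ) {g : Multiset ℕ → ℚ} (hg : ∀ s, 0 ≤ g s) :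
    IsPPositive (oddPartSeries n g) := by
  classical
  -- Positivity is strict, so partitions with coefficient 0 are dropped.
  refine ⟨((Nat.Partition.odds n).filter fun la => g la.parts ≠ 0).map
    ⟨Sigma.mk n, sigma_mk_injective⟩, fun la => g la.2.parts, ?_, ?_⟩
  · intro la hla
    obtain ⟨mu, hmu, rfl⟩ := mem_map.1 hla
    exact lt_of_le_of_ne (hg _) (mem_filter.1 hmu).2.symm
  · rw [sum_map, sum_filter, oddPartSeries]
    refine sum_congr rfl fun la _ => ?_
    split_ifs with h
    · rfl
    · rw [not_not.1 h, zero_smul]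

theorem qCoeff_nonneg (s : Multiset ℕ) : 0 ≤ qCoeff s := by
  unfold qCoeff
  positivity

theorem triangleQ_one (n : ℕ) (hn : 1 ≤ n) :
    triangleQ n 1 le_rfl hn = oddPartSeries n qCoeff := by
  obtain ⟨m, rfl⟩ : ∃ m, n = m + 1 := ⟨n - 1, by omega⟩
  rw [triangleQ_eq_wordSeries, ← qSeries_eq_oddPartSeries, ← wordSeries_isHookWord_row]
  rfl

theorem triangleQ_three (n : ℕ) (hn : 3 ≤ n) :
    triangleQ n 3 (by norm_num) hn = oddPartSeries n fun s =>
      if s.count 1 = 0 then qCoeff s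
      else if s.count 1 = 1 ∨ s.count 1 = 2 then 0
      else ((s.count 1 - 1).choose 2 : ℚ) * qCoeff s := by
  obtain ⟨m, rfl⟩ : ∃ m, n = m + 3 := ⟨n - 3, by omega⟩
  rw [triangleQ_eq_wordSeries, ← qSeries_alternating_eq, ← wordSeries_isHookWord_three]
  rfl

end SchurQ

theorem mainTheorem7 (n : ℕ) (hn : 1 ≤ n) :
    (SchurQ.triangleQ n 1 le_rfl hn =
      ∑ la ∈ Nat.Partition.odds n,
        ((SchurQ.zee la : ℚ)⁻¹ * 2 ^ la.parts.card) • SchurQ.powerSumPart la) ∧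
    (∀ hn3 : 3 ≤ n,
      SchurQ.triangleQ n 3 (by norm_num) hn3 =
        ∑ la ∈ Nat.Partition.odds n,
          (if la.parts.count 1 = 0 then (SchurQ.zee la : ℚ)⁻¹ * 2 ^ la.parts.card
            else if la.parts.count 1 = 1 ∨ la.parts.count 1 = 2 then 0
            else ((la.parts.count 1 - 1).choose 2 : ℚ) *
              ((SchurQ.zee la : ℚ)⁻¹ * 2 ^ la.parts.card)) • SchurQ.powerSumPart la) ∧
    SchurQ.IsPPositive (SchurQ.triangleQ n 1 le_rfl hn) ∧
    (∀ hn3 : 3 ≤ n, SchurQ.IsPPositive (SchurQ.triangleQ n 3 (by norm_num) hn3)) := by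
  refine ⟨SchurQ.triangleQ_one n hn, fun hn3 => SchurQ.triangleQ_three n hn3, ?_, fun hn3 => ?_⟩
  · rw [SchurQ.triangleQ_one]
    exact SchurQ.isPPositive_oddPartSeries n SchurQ.qCoeff_nonneg
  · rw [SchurQ.triangleQ_three]
    refine SchurQ.isPPositive_oddPartSeries n fun s => ?_
    have := SchurQ.qCoeff_nonneg s
    split_ifs
    · exact this
    · exact le_rfl
    · exact mul_nonneg (Nat.cast_nonneg _) this
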